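/- Two subgraphs $G'$ and $G''$ of a graph $G$ are said to align if $V(G')\subseteq V(G'')$ or $V(G'')\subseteq V(G')$. A copy of a graph $H$ in $G$ is a (not necessarily induced) subgraph of $G$ isomorphic to $H$. For graphs $H$ and $F$, let $\mathrm{ex}_{\rm re}(n,H,F)$ be the maximum, over all graphs $G$ on $n$ vertices, of the number of copies of $H$ in $G$ that align with no copy of $F$ in $G$. Then for every fixed integer $k\ge 2$, as $n\to\infty$, $$\mathrm{ex}_{\rm re}(n,K_3,C_{2k+1})=O\left(n^{1+1/k}\right),$$ where the implied constant may depend on $k$. -/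

import Mathlib

open Filter Asymptotics

/-- Two subgraphs of a graph align if the vertex set of one of them is contained in the vertex set
of the other. -/
def SubgraphsAlign {V : Type*} {G : SimpleGraph V} (G₁ G₂ : G.Subgraph) : Prop :=
  G₁.verts ⊆ G₂.verts ∨ G₂.verts ⊆ G₁.verts

/-- A subgraph of `G` is a copy of `H` in `G` if, as a graph on its own vertex set, it is
isomorphic to `H`; it need not be induced. -/
def IsCopyOf {V W : Type*} {G : SimpleGraph V} (H : SimpleGraph W) (G' : G.Subgraph) : Prop :=
  Nonempty (H ≃g G'.coe)

/-- A copy of `H` in `G` is nice with respect to `F` if it aligns with no copy of `F` in `G`. -/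
def IsNiceCopy {V W U : Type*} (H : SimpleGraph W) (F : SimpleGraph U) {G : SimpleGraph V}
    (G' : G.Subgraph) : Prop :=
  IsCopyOf H G' ∧ ∀ G'' : G.Subgraph, IsCopyOf F G'' → ¬ SubgraphsAlign G' G''

/-- The number of (unlabelled) copies of `H` in the finite graph `G` that do not align with any
copy of `F` in `G`. -/
noncomputable def niceCopyCount {V W U : Type*} [Finite V] (H : SimpleGraph W)
    (F : SimpleGraph U) (G : SimpleGraph V) : ℕ :=
  {G' : G.Subgraph | IsNiceCopy H F G'}.ncard

/-- The largest number of copies of `H` that do not align with any copy of `F`, over all graphs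
on `n` vertices. -/
noncomputable def exRe {W U : Type*} (n : ℕ) (H : SimpleGraph W) (F : SimpleGraph U) : ℕ :=
  sSup (Set.range fun G : SimpleGraph (Fin n) => niceCopyCount H F G)

/-- The supremum in the definition of `exRe` is a maximum. -/
theorem exRe_isGreatest {W U : Type*} (n : ℕ) (H : SimpleGraph W) (F : SimpleGraph U) :
    IsGreatest (Set.range fun G : SimpleGraph (Fin n) => niceCopyCount H F G) (exRe n H F) :=
  ⟨Nat.sSup_mem (Set.range_nonempty _) (Set.finite_range _).bddAbove,
    fun _ hm => le_csSup (Set.finite_range _).bddAbove hm⟩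

/-! Call a triangle nice if no cycle of length `2 * k + 1` passes through all its vertices. A
triangle copy aligning with no such cycle is nice, so it suffices to bound nice triangles.

Fix a vertex `w` and join `u`, `v` when `w`, `u`, `v` form a nice triangle. A path on `2 * k`
vertices in this link would close up through `w` to a forbidden cycle, so the link has only linearly
many edges (`sum_link_le`). Hence the triangle count is at most a constant times the number of pairs
lying in nice triangles.

For those pairs (`sum_niceEdges_le`), choose an apex for each and colour the vertices with three
colours. The pairs coloured 0, 1 with an apex coloured 2 form a bipartite graph without cycles of
length `2 * k`: replacing one edge of such a cycle by the detour through its apex, which lies off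
the cycle by its colour, gives a forbidden cycle. Bondy–Simonovits bounds each of these graphs, and
averaging over colourings costs a factor 27.

Bondy–Simonovits is proved by breadth-first search: if two consecutive levels spanned too many
edges, a dense subgraph between them would give a cycle of length `2 * k` (`not_adj_of_levels`), so
the levels grow by a factor `t` up to depth `k`, which exceeds the number of vertices. -/

namespace SimpleGraph

variable {V : Type*}

/-! ### Long paths and functions that agree at the ends of paths of fixed length -/

/-- The first `n + 1` terms of `p` form a path of length `n`. -/
def IsPathSeq (G : SimpleGraph V) (n : ℕ) (p : ℕ → V) : Prop :=
  Set.InjOn p (Set.Iic n) ∧ ∀ i < n, G.Adj (p i) (p (i + 1))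

/-- The first `n` terms of `c` form a cycle of length `n`. -/
def IsCycleSeq (G : SimpleGraph V) (n : ℕ) (c : ℕ → V) : Prop :=
  Set.InjOn c (Set.Iio n) ∧ (∀ i, i + 1 < n → G.Adj (c i) (c (i + 1))) ∧ G.Adj (c (n - 1)) (c 0)

theorem IsPathSeq.lt_card [Fintype V] {G : SimpleGraph V} {n : ℕ} {p : ℕ → V}
    (hp : G.IsPathSeq n p) : n < Fintype.card V := by
  have := Finset.card_le_card_of_injOn (s := Finset.range (n + 1)) (t := Finset.univ) p
    (by simp) (hp.1.mono fun x => by simp)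
  simpa using this

/-- Every path extends to one whose last vertex has all its neighbours on the path. -/
theorem IsPathSeq.exists_maximal [Fintype V] {G : SimpleGraph V} {n : ℕ} {p : ℕ → V}
    (hp : G.IsPathSeq n p) : ∃ N q, n ≤ N ∧ (∀ i ≤ n, q i = p i) ∧ G.IsPathSeq N q ∧
      ∀ u, G.Adj (q N) u → ∃ j < N, q j = u := by
  induction hm : Fintype.card V - n using Nat.strong_induction_on generalizing n p with
  | _ m ih =>
  by_cases hmax : ∀ u, G.Adj (p n) u → ∃ j < n, p j = u
  · exact ⟨n, p, le_rfl, fun _ _ => rfl, hp, hmax⟩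
  push Not at hmax
  obtain ⟨u, hu, hne⟩ := hmax
  have hq : G.IsPathSeq (n + 1) (Function.update p (n + 1) u) := by
    have hne' : ∀ j ≤ n, p j ≠ u := fun j hj => by
      rcases hj.lt_or_eq with h | rfl
      · exact hne j h
      · exact hu.ne
    refine ⟨fun i hi j hj hij => ?_, fun i hi => ?_⟩
    · simp only [Set.mem_Iic] at hi hj
      simp only [Function.update_apply] at hij
      split_ifs at hij with h1 h2 h2
      · omega
      · exact absurd hij.symm (hne' j (by omega))
      · exact absurd hij (hne' i (by omega))
      · exact hp.1 (by simp; omega) (by simp; omega) hij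
    · simp only [Function.update_apply]
      rw [if_neg (by omega)]
      split_ifs with h2
      · obtain rfl : i = n := by omega
        exact hu
      · exact hp.2 i (by omega)
  have hlt := hp.lt_card
  obtain ⟨N, q, h1, h2, h3, h4⟩ := ih _ (by omega) hq rfl
  refine ⟨N, q, by omega, fun i hi => ?_, h3, h4⟩
  rw [h2 i (by omega), Function.update_of_ne (by omega)]

/-- Suppose that all non-isolated vertices have large degree and that `f` takes equal values at the
ends of every path of a fixed even length. Then `f` is constant on every neighbourhood. -/
theorem apply_eq_of_adj_of_adj [Fintype V] {G : SimpleGraph V} [DecidableRel G.Adj] {α : Type*}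
    {f : V → α} {l : ℕ} (hl : Even l) (hl0 : 0 < l)
    (hdeg : ∀ v, (∃ u, G.Adj v u) → 3 * l ≤ (Finset.univ.filter (G.Adj v)).card)
    (hf : ∀ q, G.IsPathSeq l q → f (q 0) = f (q l)) {z a b : V} (ha : G.Adj z a)
    (hb : G.Adj z b) : f a = f b := by
  classical
  rcases eq_or_ne a b with rfl | hab
  · rfl
  have hp0 : G.IsPathSeq 2 (fun i => if i = 0 then a else if i = 1 then z else b) := by
    refine ⟨fun i hi j hj hij => ?_, fun i hi => ?_⟩
    · simp only [Set.mem_Iic] at hi hj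
      have := ha.ne
      have := hb.ne
      interval_cases i <;> interval_cases j <;> simp_all
    · interval_cases i
      · simpa using ha.symm
      · simpa using hb
  obtain ⟨N, p, hN, hpp, hp, hmax⟩ := hp0.exists_maximal
  have hpa : p 0 = a := by simpa using hpp 0 (by omega)
  have hpb : p 2 = b := by simpa using hpp 2 (by omega)
  set J := (Finset.range N).filter fun j => G.Adj (p N) (p j) with hJ
  have hJcard : 3 * l ≤ J.card := by
    refine (hdeg (p N) ⟨p (N - 1), ?_⟩).trans ?_
    · have := hp.2 (N - 1) (by omega)
      rw [Nat.sub_add_cancel (by omega)] at this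
      exact this.symm
    · refine (Finset.card_le_card (t := J.image p) fun u hu => ?_).trans Finset.card_image_le
      obtain ⟨j, hj, rfl⟩ := hmax u (by simpa using hu)
      exact Finset.mem_image_of_mem _ (by simpa [hJ, hj] using hu)
  have hJadj : ∀ j ∈ J, G.Adj (p N) (p j) := fun j hj => by simp [hJ] at hj; exact hj.2
  have hJlt : ∀ j ∈ J, j < N := fun j hj => by simp [hJ] at hj; exact hj.1
  -- The end `p N` sends two chords back to the path with room `l` before, between and after them:
  -- otherwise `J` lies in three intervals of total size at most `3 * l - 1`.
  obtain ⟨j, j', hj, hj', hlj, hjj', hj'N⟩ :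
      ∃ j j', j ∈ J ∧ j' ∈ J ∧ l ≤ j ∧ j + l ≤ j' ∧ j' + l ≤ N := by
    have hne : (J.filter (l ≤ ·)).Nonempty := by
      by_contra h
      rw [Finset.not_nonempty_iff_eq_empty, Finset.filter_eq_empty_iff] at h
      have := Finset.card_le_card (s := J) (t := Finset.range l) fun x hx => by
        have := h hx
        simp; omega
      simp at this; omega
    set j := (J.filter (l ≤ ·)).min' hne with hjdef
    have hj := Finset.min'_mem _ hne
    rw [← hjdef, Finset.mem_filter] at hj
    by_contra hcon
    push Not at hcon
    have hsub : J ⊆ Finset.range l ∪ (Finset.Ico j (j + l) ∪ Finset.Ico (N - l + 1) N) := by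
      intro x hx
      have h1 := hcon j x hj.1 hx hj.2
      have h2 := hJlt x hx
      simp only [Finset.mem_union, Finset.mem_range, Finset.mem_Ico]
      by_cases hxl : x < l
      · exact Or.inl hxl
      have h3 : j ≤ x := Finset.min'_le _ _ (by simp [hx]; omega)
      omega
    have h1 := Finset.card_le_card hsub
    have h2 := Finset.card_union_le (Finset.range l)
      (Finset.Ico j (j + l) ∪ Finset.Ico (N - l + 1) N)
    have h3 := Finset.card_union_le (Finset.Ico j (j + l)) (Finset.Ico (N - l + 1) N)
    simp only [Finset.card_range, Nat.card_Ico] at h1 h2 h3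
    omega
  have key : ∀ s : ℕ → ℕ, (∀ i ≤ l, s i ≤ N) → (∀ i i', i < i' → i' ≤ l → s i ≠ s i') →
      (∀ i < l, s (i + 1) = s i + 1 ∨ s i = s (i + 1) + 1 ∨
        (s i = N ∧ (s (i + 1) = j ∨ s (i + 1) = j')) ∨
        (s (i + 1) = N ∧ (s i = j ∨ s i = j'))) → f (p (s 0)) = f (p (s l)) := by
    intro s hs hinj hadj
    refine hf (fun i => p (s i)) ⟨fun i hi i' hi' h => ?_, fun i hi => ?_⟩
    · simp only [Set.mem_Iic] at hi hi'
      have := hp.1 (hs i hi) (hs i' hi') h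
      rcases lt_trichotomy i i' with h | h | h
      · exact absurd this (hinj _ _ h hi')
      · exact h
      · exact absurd this.symm (hinj _ _ h hi)
    · have h1 := hs i hi.le
      have h2 := hs (i + 1) hi
      rcases hadj i hi with h | h | ⟨h, h' | h'⟩ | ⟨h, h' | h'⟩
      · simp only [h]; exact hp.2 _ (by omega)
      · simp only [h]; exact (hp.2 _ (by omega)).symm
      · simp only [h, h']; exact hJadj _ hj
      · simp only [h, h']; exact hJadj _ hj'
      · simp only [h, h']; exact (hJadj _ hj).symm
      · simp only [h, h']; exact (hJadj _ hj').symm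
  have hper : ∀ i, i + l ≤ N → f (p i) = f (p (i + l)) := fun i hi =>
    key (fun t => i + t) (by intros; omega) (by intros; omega) (by intros; omega)
  -- Three detours of length `l`: through the chord at `j`, through the chord at `j'`, and through
  -- both. Together with `hper` they show that `f ∘ p` has period 2 just before `j`.
  have hfwd : ∀ x < l, f (p (j - x)) = f (p (N - (l - x - 1))) := fun x hx => by
    have := key (fun i => if i ≤ x then j - x + i else N - (i - x - 1))
      (by intros; split_ifs <;> omega) (by intros; split_ifs <;> omega)
      (by intros; split_ifs <;> omega)
    simpa [Nat.not_le.2 hx] using this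
  have hbwd : ∀ x < l, f (p (j' + x)) = f (p (N - (l - x - 1))) := fun x hx => by
    have := key (fun i => if i ≤ x then j' + x - i else N - (i - x - 1))
      (by intros; split_ifs <;> omega) (by intros; split_ifs <;> omega)
      (by intros; split_ifs <;> omega)
    simpa [Nat.not_le.2 hx] using this
  have htwo : ∀ x, x + 2 ≤ l → f (p (j' + x)) = f (p (j + (l - x - 2))) := fun x hx => by
    have := key (fun i => if i ≤ x then j' + x - i else if i = x + 1 then N else j + (i - x - 2))
      (by intros; split_ifs <;> omega) (by intros; split_ifs <;> omega)
      (by intros; split_ifs <;> omega)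
    simpa [show ¬ l ≤ x by omega, show ¬ l = x + 1 by omega] using this
  have hwin : ∀ i, j ≤ i + l → i + 2 ≤ j → f (p i) = f (p (i + 2)) := fun i h1 h2 => by
    have e1 := hfwd (j - 2 - i) (by omega)
    have e2 := hbwd (j - 2 - i) (by omega)
    have e3 := htwo (j - 2 - i) (by omega)
    have e4 := hper i (by omega)
    rw [show j - (j - 2 - i) = i + 2 by omega] at e1
    rw [show j + (l - (j - 2 - i) - 2) = i + l by omega] at e3
    rw [e1, ← e2, e3, e4]
  have hall : ∀ d i, i + 2 + d = j → f (p i) = f (p (i + 2)) := by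
    intro d
    induction d using Nat.strong_induction_on with
    | _ d ih =>
    intro i hi
    by_cases h1 : j ≤ i + l
    · exact hwin i h1 (by omega)
    by_cases h2 : i + 2 + l ≤ j
    · rw [hper i (by omega), hper (i + 2) (by omega), ih (d - l) (by omega) (i + l) (by omega)]
      congr 2; omega
    -- Here `j = i + l + 1`, so `i` is just outside the window. Steps of 2 lead from `i + 2` to `i +
    -- l` because `l` is even, and the period `l` leads back to `i`.
    · have hchain : ∀ s, 2 * s + 2 ≤ l → f (p (i + 2)) = f (p (i + 2 + 2 * s)) := by
        intro s
        induction s with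
        | zero => simp
        | succ s ihs =>
          intro hs
          rw [ihs (by omega), hwin _ (by omega) (by omega)]
          congr 2
      obtain ⟨m, rfl⟩ := hl
      rw [hchain (m - 1) (by omega), hper i (by omega)]
      congr 2; omega
  have := hall (j - 2) 0 (by have := hl.two_dvd; have := Nat.le_of_dvd hl0 this; omega)
  rwa [hpa, zero_add, hpb] at this

/-! ### Even cycles and the Bondy–Simonovits theorem -/

open Classical in
/-- A graph with many edges on `S` has a nonempty subgraph of large minimum degree. -/
theorem exists_le_minDegree [Fintype V] (G : SimpleGraph V) {S : Finset V} {d : ℕ}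
    (h : 2 * d * S.card < ∑ v ∈ S, (S.filter (G.Adj v)).card) :
    ∃ H ≤ G, (∃ u v, H.Adj u v) ∧
      ∀ v, (∃ u, H.Adj v u) → d ≤ (Finset.univ.filter (H.Adj v)).card := by
  induction S using Finset.strongInduction with
  | H S ih =>
  by_cases hd : ∀ v ∈ S, d ≤ (S.filter (G.Adj v)).card
  · obtain ⟨H, hH⟩ : ∃ H : SimpleGraph V, ∀ u v, H.Adj u v ↔ G.Adj u v ∧ u ∈ S ∧ v ∈ S :=
      ⟨{ Adj := fun u v => G.Adj u v ∧ u ∈ S ∧ v ∈ S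
         symm := ⟨fun u v h => ⟨h.1.symm, h.2.2, h.2.1⟩⟩
         loopless := ⟨fun u h => G.loopless.irrefl u h.1⟩ }, fun _ _ => Iff.rfl⟩
    refine ⟨H, fun u v h => ((hH _ _).1 h).1, ?_, ?_⟩
    · by_contra hcon
      push Not at hcon
      have : ∑ v ∈ S, (S.filter (G.Adj v)).card = 0 :=
        Finset.sum_eq_zero fun v hv => Finset.card_eq_zero.2 <|
          Finset.filter_eq_empty_iff.2 fun u hu hadj => hcon v u ((hH _ _).2 ⟨hadj, hv, hu⟩)
      omega
    · rintro v ⟨u, hu⟩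
      rw [hH] at hu
      refine (hd v hu.2.1).trans (Finset.card_le_card fun x hx => ?_)
      rw [Finset.mem_filter] at hx
      exact Finset.mem_filter.2 ⟨Finset.mem_univ _, (hH _ _).2 ⟨hx.2, hu.2.1, hx.1⟩⟩
  · push Not at hd
    obtain ⟨v, hv, hvd⟩ := hd
    have hsub := Finset.erase_ssubset hv
    have hcard := Finset.card_erase_add_one hv
    have hdeg : ∀ u ∈ S.erase v, (S.filter (G.Adj u)).card =
        ((S.erase v).filter (G.Adj u)).card + if G.Adj v u then 1 else 0 := by
      intro u _
      conv_lhs => rw [← Finset.insert_erase hv, Finset.filter_insert]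
      simp only [G.adj_comm u v]
      split_ifs with h
      · rw [Finset.card_insert_of_notMem (by simp)]
      · rfl
    have hsum : ∑ u ∈ S.erase v, (if G.Adj v u then 1 else 0) ≤ (S.filter (G.Adj v)).card := by
      rw [Finset.sum_boole]
      exact_mod_cast Finset.card_le_card (Finset.filter_subset_filter _ hsub.1)
    -- Deleting `v` lowers the degree sum by at most twice its degree, which is less than `2 * d`,
    -- so the density hypothesis survives.
    rw [← Finset.add_sum_erase _ _ hv, Finset.sum_congr rfl hdeg, Finset.sum_add_distrib] at h
    exact ih (S.erase v) hsub (by rw [← hcard] at h; nlinarith)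

theorem level_iterate {lev : V → ℕ} {par : V → V} {k : ℕ}
    (hpar : ∀ v, 0 < lev v → lev v ≤ k → lev (par v) + 1 = lev v) {v : V} (hv : lev v ≤ k) :
    ∀ {s}, s ≤ lev v → lev (par^[s] v) + s = lev v
  | 0, _ => rfl
  | s + 1, hs => by
    have ih := level_iterate hpar hv (s := s) (by omega)
    have := hpar (par^[s] v) (by omega) (by omega)
    rw [Function.iterate_succ_apply']
    omega

/-- Closing up a path between two levels of a tree by the two tree paths to the lowest common
ancestor of its ends. -/
theorem exists_isCycleSeq_of_isPathSeq {G : SimpleGraph V} {lev : V → ℕ} {par : V → V} {k : ℕ}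
    (hpar : ∀ v, 0 < lev v → lev v ≤ k → G.Adj v (par v) ∧ lev (par v) + 1 = lev v)
    {i h l : ℕ} (hik : i ≤ k) (hhi : h + 1 ≤ i) (hl : 0 < l) {q : ℕ → V} (hq : G.IsPathSeq l q)
    (hlev : ∀ s ≤ l, i ≤ lev (q s)) (h0 : lev (q 0) = i) (h1 : lev (q l) = i)
    (hne : par^[h] (q 0) ≠ par^[h] (q l)) (heq : par^[h + 1] (q 0) = par^[h + 1] (q l)) :
    ∃ c, G.IsCycleSeq (l + 2 * (h + 1)) c := by
  have hit : ∀ {v s}, lev v = i → s ≤ i → lev (par^[s] v) + s = i := fun {v s} hv hs => by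
    have := level_iterate (fun v a b => (hpar v a b).2) (v := v) (hv ▸ hik) (s := s) (hv ▸ hs)
    omega
  have hsep : ∀ s ≤ h, par^[s] (q 0) ≠ par^[s] (q l) := fun s hs hs' => hne (by
    rw [← Nat.sub_add_cancel hs, Function.iterate_add_apply, Function.iterate_add_apply, hs'])
  have hadj : ∀ {v s}, lev v = i → s < i → G.Adj (par^[s] v) (par^[s + 1] v) :=
    fun {v s} hv hs => by
      have := hit hv hs.le
      rw [Function.iterate_succ_apply']
      exact (hpar _ (by omega) (by omega)).1
  -- Follow `q`, climb from `q l` to the common ancestor, then descend to `q 0`. Repetitions are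
  -- excluded by levels: at least `i` on `q`, below `i` on the branches; the branches are separated
  -- by `hsep`.
  let c : ℕ → V := fun t => if t ≤ l then q t else
    if t ≤ l + (h + 1) then par^[t - l] (q l) else par^[l + 2 * (h + 1) - t] (q 0)
  have c1 : ∀ t ≤ l, c t = q t := fun t ht => if_pos ht
  have c2 : ∀ t, l ≤ t → t ≤ l + (h + 1) → c t = par^[t - l] (q l) := fun t ht ht' => by
    rcases ht.eq_or_lt with rfl | ht
    · simp [c]
    · simp only [c]
      rw [if_neg (by omega), if_pos ht']
  have c3 : ∀ t, l + (h + 1) ≤ t → c t = par^[l + 2 * (h + 1) - t] (q 0) := fun t ht => by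
    rcases ht.eq_or_lt with rfl | ht
    · rw [c2 _ (by omega) le_rfl, show l + (h + 1) - l = h + 1 by omega,
        show l + 2 * (h + 1) - (l + (h + 1)) = h + 1 by omega, heq]
    · simp only [c]
      rw [if_neg (by omega), if_neg (by omega)]
  have hinj : ∀ t t', t < t' → t' < l + 2 * (h + 1) → c t ≠ c t' := by
    intro t t' htt ht' hc
    by_cases h2 : t' ≤ l
    · rw [c1 t (by omega), c1 t' h2] at hc
      have := hq.1 (by simp; omega) (by simpa using h2) hc
      omega
    by_cases h3 : t' ≤ l + (h + 1)
    · have e' := hit h1 (s := t' - l) (by omega)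
      rw [← c2 t' (by omega) h3, ← hc] at e'
      by_cases h4 : t ≤ l
      · have := hlev t h4
        rw [c1 t h4] at e'
        omega
      · have e := hit h1 (s := t - l) (by omega)
        rw [← c2 t (by omega) (by omega)] at e
        omega
    · have e' := hit h0 (s := l + 2 * (h + 1) - t') (by omega)
      rw [← c3 t' (by omega), ← hc] at e'
      by_cases h4 : t ≤ l
      · have := hlev t h4
        rw [c1 t h4] at e'
        omega
      by_cases h5 : t ≤ l + (h + 1)
      · have e := hit h1 (s := t - l) (by omega)
        rw [← c2 t (by omega) (by omega)] at e
        rw [c2 t (by omega) h5, c3 t' (by omega),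
          show l + 2 * (h + 1) - t' = t - l by omega] at hc
        exact hsep _ (by omega) hc.symm
      · have e := hit h0 (s := l + 2 * (h + 1) - t) (by omega)
        rw [← c3 t (by omega)] at e
        omega
  refine ⟨c, fun t ht t' ht' hc => ?_, fun t ht => ?_, ?_⟩
  · rcases lt_trichotomy t t' with h | h | h
    · exact absurd hc (hinj _ _ h ht')
    · exact h
    · exact absurd hc.symm (hinj _ _ h ht)
  · by_cases h2 : t + 1 ≤ l
    · rw [c1 _ (by omega), c1 _ h2]
      exact hq.2 t (by omega)
    by_cases h3 : t + 1 ≤ l + (h + 1)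
    · rw [c2 _ (by omega) (by omega), c2 _ (by omega) h3,
        show t + 1 - l = t - l + 1 by omega]
      exact hadj h1 (by omega)
    · rw [c3 _ (by omega), c3 _ (by omega),
        show l + 2 * (h + 1) - t = l + 2 * (h + 1) - (t + 1) + 1 by omega]
      exact (hadj h0 (by omega)).symm
  · rw [c3 _ (by omega), c1 0 (by omega),
      show l + 2 * (h + 1) - (l + 2 * (h + 1) - 1) = 0 + 1 by omega]
    exact (hadj (s := 0) h0 (by omega)).symm

/-- In a graph without cycles of length `2 * k`, no graph of large minimum degree lives between two
consecutive levels of a breadth-first search tree. -/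
theorem not_adj_of_levels [Fintype V] {G H : SimpleGraph V} [DecidableRel H.Adj] {lev : V → ℕ}
    {par : V → V} {k : ℕ} (hcyc : ∀ c, ¬ G.IsCycleSeq (2 * k) c)
    (hroot : ∀ u v, lev u = 0 → lev v = 0 → u = v)
    (hpar : ∀ v, 0 < lev v → lev v ≤ k → G.Adj v (par v) ∧ lev (par v) + 1 = lev v)
    {i : ℕ} (hik : i < k) (hle : H ≤ G)
    (hlev : ∀ u v, H.Adj u v → (lev u = i ∧ lev v = i + 1) ∨ (lev u = i + 1 ∧ lev v = i))
    (hdeg : ∀ v, (∃ u, H.Adj v u) → 6 * k ≤ (Finset.univ.filter (H.Adj v)).card) (u v : V) :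
    ¬ H.Adj u v := by
  classical
  intro huv
  -- Common ancestors are pushed down the tree: at height `h = i` the ancestor is the root, and at
  -- height `h = 0` the statement makes distinct neighbours equal.
  have main : ∀ d h, h + d = i → ∀ z a b, H.Adj z a → H.Adj z b → lev a = i → lev b = i →
      par^[h] a = par^[h] b := by
    intro d
    induction d with
    | zero =>
      rintro h rfl z a b - - ha hb
      have e1 := level_iterate (fun v x y => (hpar v x y).2) (v := a) (by omega) (s := h)
        (by omega)
      have e2 := level_iterate (fun v x y => (hpar v x y).2) (v := b) (by omega) (s := h)
        (by omega)
      exact hroot _ _ (by omega) (by omega)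
    | succ d ih =>
      intro h hd z a b hza hzb ha hb
      -- The length is chosen so that a path plus two branches of length `h + 1` has total length `2
      -- * k`. The value `a` off level `i` is arbitrary: it makes paths starting on level `i + 1`
      -- trivial.
      have := apply_eq_of_adj_of_adj (G := H) (f := fun v => if lev v = i then par^[h] v else a)
        (l := 2 * (k - (h + 1))) (even_two_mul _) (by omega)
        (fun v hv => le_trans (by omega) (hdeg v hv)) ?_ hza hzb
      · simpa [ha, hb] using this
      intro q hq
      set m := k - (h + 1) with hm
      have hlevq : ∀ s ≤ 2 * m, lev (q s) = i ∨ lev (q s) = i + 1 := by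
        intro s hs
        rcases hs.eq_or_lt with rfl | hs
        · have := hlev _ _ (hq.2 (2 * m - 1) (by omega))
          rw [Nat.sub_add_cancel (by omega)] at this
          omega
        · have := hlev _ _ (hq.2 s hs)
          omega
      have hstep : ∀ s, 2 * s ≤ 2 * m → lev (q (2 * s)) = lev (q 0) := by
        intro s
        induction s with
        | zero => simp
        | succ s ihs =>
          intro hs
          have h1 := hlev _ _ (hq.2 (2 * s) (by omega))
          have h2 := hlev _ _ (hq.2 (2 * s + 1) (by omega))
          have h3 := ihs (by omega)
          rw [show 2 * (s + 1) = 2 * s + 1 + 1 by ring]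
          omega
      by_cases h0 : lev (q 0) = i
      · have hanc : ∀ s, 2 * s ≤ 2 * m → par^[h + 1] (q 0) = par^[h + 1] (q (2 * s)) := by
          intro s
          induction s with
          | zero => simp
          | succ s ihs =>
            intro hs
            rw [ihs (by omega)]
            exact ih (h + 1) (by omega) (q (2 * s + 1)) _ _ (hq.2 (2 * s) (by omega)).symm
              (hq.2 (2 * s + 1) (by omega)) ((hstep s (by omega)).trans h0)
              ((hstep (s + 1) (by omega)).trans h0)
        have h1 : lev (q (2 * m)) = i := (hstep m le_rfl).trans h0
        simp only [h0, h1, if_true]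
        by_contra hne
        obtain ⟨c, hc⟩ := exists_isCycleSeq_of_isPathSeq hpar (i := i) (h := h) (by omega)
          (by omega) (l := 2 * m) (by omega) ⟨hq.1, fun s hs => hle (hq.2 s hs)⟩
          (fun s hs => by have := hlevq s hs; omega) h0 h1 hne (hanc m le_rfl)
        rw [show 2 * m + 2 * (h + 1) = 2 * k by omega] at hc
        exact hcyc c hc
      · have h1 := hstep m le_rfl
        simp [h0, h1]
  obtain ⟨z, y, hz, hzy⟩ : ∃ z y, lev z = i + 1 ∧ H.Adj z y := by
    rcases hlev u v huv with h | h
    · exact ⟨v, u, h.2, huv.symm⟩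
    · exact ⟨u, v, h.1, huv⟩
  have h2 := hdeg z ⟨y, hzy⟩
  obtain ⟨a, ha, b, hb, hab⟩ := Finset.one_lt_card.1
    (show 1 < (Finset.univ.filter (H.Adj z)).card by omega)
  simp only [Finset.mem_filter, Finset.mem_univ, true_and] at ha hb
  have ha' := hlev _ _ ha
  have hb' := hlev _ _ hb
  exact hab (main i 0 (by omega) z a b ha hb (by omega) (by omega))

/-- Breadth-first search in a bipartite graph, up to depth `k`. -/
theorem exists_levels (G : SimpleGraph V) {col : V → Bool}
    (hcol : ∀ u v, G.Adj u v → col u ≠ col v) (r : V) (k : ℕ) :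
    ∃ (lev : V → ℕ) (par : V → V), (∀ v, lev v = 0 ↔ v = r) ∧
      (∀ v, 0 < lev v → lev v ≤ k → G.Adj v (par v) ∧ lev (par v) + 1 = lev v) ∧
      ∀ u v, lev u ≤ k → G.Adj u v → lev v = lev u + 1 ∨ lev u = lev v + 1 := by
  classical
  -- Distance is 0 between disconnected vertices, so unreachable ones are sent beyond depth `k`.
  let lev : V → ℕ := fun v => if G.Reachable v r then G.dist v r else k + 1
  have hlev : ∀ {v}, G.Reachable v r → lev v = G.dist v r := fun h => if_pos h
  have hreach : ∀ v, lev v ≤ k → G.Reachable v r := fun v hv => by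
    by_contra h
    simp only [lev, if_neg h] at hv
    omega
  have hdist : ∀ u v, G.Reachable u r → G.Adj u v →
      lev v = lev u + 1 ∨ lev u = lev v + 1 := by
    intro u v hu huv
    have hv : G.Reachable v r := huv.symm.reachable.trans hu
    rw [hlev hu, hlev hv]
    obtain ⟨p, hp⟩ := hu.exists_walk_length_eq_dist
    obtain ⟨p', hp'⟩ := hv.exists_walk_length_eq_dist
    have h1 := G.dist_le (Walk.cons huv p')
    have h2 := G.dist_le (Walk.cons huv.symm p)
    let C : G.Coloring Bool := Coloring.mk col fun {u v} h => hcol u v h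
    have e1 := C.even_length_iff_congr p
    have e2 := C.even_length_iff_congr p'
    -- The two-colouring fixes the parity of distances to `r`, so adjacent vertices are never on the
    -- same level.
    have e3 : C u ≠ C v := C.valid huv
    rw [Walk.length_cons] at h1 h2
    have : G.dist u r ≠ G.dist v r := fun h => by
      rw [hp] at e1
      rw [hp', ← h, e1] at e2
      revert e2 e3
      cases C u <;> cases C v <;> cases C r <;> simp
    omega
  have hp : ∀ v, ∃ w, 0 < lev v → lev v ≤ k → G.Adj v w ∧ lev w + 1 = lev v := by
    intro v
    by_cases hv : 0 < lev v ∧ lev v ≤ k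
    · have hr := hreach v hv.2
      obtain ⟨p, hp⟩ := hr.exists_walk_length_eq_dist
      rw [← hlev hr] at hp
      cases p with
      | nil => simp at hp; omega
      | cons hadj p =>
        rename_i w
        refine ⟨w, fun _ _ => ⟨hadj, ?_⟩⟩
        have h1 := hdist v w hr hadj
        have h2 := G.dist_le p
        rw [← hlev (hadj.symm.reachable.trans hr)] at h2
        rw [Walk.length_cons] at hp
        omega
    · exact ⟨v, fun h1 h2 => absurd ⟨h1, h2⟩ hv⟩
  choose par hpar using hp
  refine ⟨lev, par, fun v => ⟨fun h => ?_, ?_⟩, hpar, fun u v hu huv => hdist u v (hreach u hu) huv⟩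
  · have hr := hreach v (by omega)
    rw [hlev hr] at h
    exact hr.dist_eq_zero_iff.1 h
  · rintro rfl
    rw [hlev (Reachable.refl v)]
    simp

open Classical in
/-- The **Bondy–Simonovits theorem** for bipartite graphs. -/
theorem sum_degree_le_of_forall_not_isCycleSeq [Fintype V] {G : SimpleGraph V} {col : V → Bool}
    (hcol : ∀ u v, G.Adj u v → col u ≠ col v) {k t : ℕ} (hk : 0 < k) (ht : 0 < t)
    (hcyc : ∀ c, ¬ G.IsCycleSeq (2 * k) c) (hcard : Fintype.card V < t ^ k) :
    ∑ v, (Finset.univ.filter (G.Adj v)).card ≤ 2 * (6 * k * (t + 3)) * Fintype.card V := by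
  by_contra hcon
  push Not at hcon
  obtain ⟨H, hHG, ⟨r, r', hrr⟩, hdeg⟩ :=
    exists_le_minDegree G (S := Finset.univ) (d := 6 * k * (t + 3)) (by simpa using hcon)
  obtain ⟨lev, par, hroot, hpar, hnbr⟩ :=
    exists_levels H (fun u v h => hcol u v (hHG h)) r k
  have hcycH : ∀ c, ¬ H.IsCycleSeq (2 * k) c := fun c hc =>
    hcyc c ⟨hc.1, fun i hi => hHG (hc.2.1 i hi), hHG hc.2.2⟩
  let L : ℕ → Finset V := fun i => Finset.univ.filter fun v => lev v = i
  have hL : ∀ {i v}, v ∈ L i ↔ lev v = i := by simp [L]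
  let e : ℕ → ℕ := fun i => ∑ v ∈ L i, ((L (i + 1)).filter (H.Adj v)).card
  have hesymm : ∀ i, e i = ∑ v ∈ L (i + 1), ((L i).filter (H.Adj v)).card := fun i => by
    simp only [e]
    have := Finset.sum_card_bipartiteAbove_eq_sum_card_bipartiteBelow (s := L i) (t := L (i + 1))
      H.Adj
    simp only [Finset.bipartiteAbove, Finset.bipartiteBelow] at this
    convert this using 4
    all_goals simp [H.adj_comm]
  have hele : ∀ i < k, e i ≤ 6 * k * ((L i).card + (L (i + 1)).card) := by
    intro i hi
    by_contra hlt
    push Not at hlt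
    obtain ⟨B, hB⟩ : ∃ B : SimpleGraph V, ∀ u v, B.Adj u v ↔
        H.Adj u v ∧ ((lev u = i ∧ lev v = i + 1) ∨ (lev u = i + 1 ∧ lev v = i)) :=
      ⟨{ Adj := fun u v => H.Adj u v ∧
          ((lev u = i ∧ lev v = i + 1) ∨ (lev u = i + 1 ∧ lev v = i))
         symm := ⟨fun u v h => ⟨h.1.symm, by tauto⟩⟩
         loopless := ⟨fun u h => H.loopless.irrefl u h.1⟩ }, fun _ _ => Iff.rfl⟩
    have hdisj : Disjoint (L i) (L (i + 1)) := Finset.disjoint_left.2 fun v h1 h2 => by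
      rw [hL] at h1 h2; omega
    -- Each edge is counted from both ends, which matches the factor 2 in `exists_le_minDegree`.
    have hsum : 2 * e i ≤ ∑ v ∈ L i ∪ L (i + 1), ((L i ∪ L (i + 1)).filter (B.Adj v)).card := by
      rw [Finset.sum_union hdisj, two_mul]
      refine add_le_add (Finset.sum_le_sum fun v hv => Finset.card_le_card fun u hu => ?_)
        ((hesymm i).le.trans
          (Finset.sum_le_sum fun v hv => Finset.card_le_card fun u hu => ?_))
      all_goals
        rw [Finset.mem_filter] at hu
        obtain ⟨hu1, hu2⟩ := hu
        rw [Finset.mem_filter, Finset.mem_union, hB]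
        rw [hL] at hv
        refine ⟨by tauto, hu2, ?_⟩
        rw [hL] at hu1
        omega
    obtain ⟨K, hKB, ⟨u, v, huv⟩, hK⟩ := exists_le_minDegree B
      (S := L i ∪ L (i + 1)) (d := 6 * k) (by rw [Finset.card_union_of_disjoint hdisj]; linarith)
    exact not_adj_of_levels hcycH (fun u v hu hv => ((hroot u).1 hu).trans ((hroot v).1 hv).symm)
      hpar hi (fun u v h => ((hB _ _).1 (hKB h)).1)
      (fun u v h => ((hB _ _).1 (hKB h)).2) hK u v huv
  have hdegL : ∀ i < k, ∀ v ∈ L i, 6 * k * (t + 3) ≤ (Finset.univ.filter (H.Adj v)).card := by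
    intro i hi v hv
    rw [hL] at hv
    apply hdeg
    rcases Nat.eq_zero_or_pos (lev v) with h | h
    · obtain rfl := (hroot v).1 h
      exact ⟨r', hrr⟩
    · exact ⟨_, (hpar v h (by omega)).1⟩
  have hgrow : ∀ i < k, t * (L i).card ≤ (L (i + 1)).card := by
    intro i
    induction i with
    | zero =>
      intro hi
      have h1 : (L 0).card * (6 * k * (t + 3)) ≤ e 0 := by
        rw [← smul_eq_mul, ← Finset.sum_const]
        refine Finset.sum_le_sum fun v hv => (hdegL 0 hi v hv).trans
          (Finset.card_le_card fun u hu => ?_)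
        rw [hL] at hv
        simp only [Finset.mem_filter, Finset.mem_univ, true_and] at hu
        have := hnbr v u (by omega) hu
        rw [Finset.mem_filter, hL]
        exact ⟨by omega, hu⟩
      have h2 := h1.trans (hele 0 hi)
      have h3 : (L 0).card * (t + 3) ≤ (L 0).card + (L (0 + 1)).card := by
        refine Nat.le_of_mul_le_mul_left (c := 6 * k) ?_ (by omega)
        calc _ = (L 0).card * (6 * k * (t + 3)) := by ring
          _ ≤ _ := h2
      nlinarith
    | succ i ih =>
      intro hi
      have ih := ih (by omega)
      have h1 : (L (i + 1)).card * (6 * k * (t + 3)) ≤ e i + e (i + 1) := by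
        rw [← smul_eq_mul, ← Finset.sum_const, hesymm i, ← Finset.sum_add_distrib]
        refine Finset.sum_le_sum fun v hv => (hdegL _ hi v hv).trans
          ((Finset.card_le_card fun u hu => ?_).trans (Finset.card_union_le _ _))
        rw [hL] at hv
        simp only [Finset.mem_filter, Finset.mem_univ, true_and] at hu
        have := hnbr v u (by omega) hu
        simp only [Finset.mem_union, Finset.mem_filter, hL]
        have : lev u = i ∨ lev u = i + 1 + 1 := by omega
        tauto
      have h2 := h1.trans (add_le_add (hele i (by omega)) (hele (i + 1) hi))
      -- Of `t + 3`, two units pay for the copies of level `i + 1` on the right and one for level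
      -- `i`, no larger by induction; growth by `t` remains.
      have h3 : (L (i + 1)).card * (t + 3) ≤
          (L i).card + (L (i + 1)).card + ((L (i + 1)).card + (L (i + 1 + 1)).card) := by
        refine Nat.le_of_mul_le_mul_left (c := 6 * k) ?_ (by omega)
        calc _ = (L (i + 1)).card * (6 * k * (t + 3)) := by ring
          _ ≤ _ := h2
          _ = _ := by ring
      have h4 : (L i).card ≤ t * (L i).card := Nat.le_mul_of_pos_left _ ht
      nlinarith
  have hpow : ∀ i ≤ k, t ^ i ≤ (L i).card := by
    intro i
    induction i with
    | zero =>
      intro _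
      exact Finset.card_pos.2 ⟨r, hL.2 ((hroot r).2 rfl)⟩
    | succ i ih =>
      intro hi
      calc t ^ (i + 1) = t * t ^ i := by ring
        _ ≤ t * (L i).card := Nat.mul_le_mul_left _ (ih (by omega))
        _ ≤ _ := hgrow i (by omega)
  have := (hpow k le_rfl).trans (Finset.card_le_univ _)
  omega

/-! ### Counting nice triangles through links and edges -/

/-- `u`, `v`, `w` form a triangle contained in no cycle of length `n`. -/
def IsNiceTriangle (G : SimpleGraph V) (n : ℕ) (u v w : V) : Prop :=
  G.Adj u v ∧ G.Adj u w ∧ G.Adj v w ∧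
    ∀ c, G.IsCycleSeq n c → ¬ ∀ x, x = u ∨ x = v ∨ x = w → ∃ i < n, c i = x

theorem IsNiceTriangle.swap {G : SimpleGraph V} {n : ℕ} {u v w : V}
    (h : G.IsNiceTriangle n u v w) : G.IsNiceTriangle n v u w :=
  ⟨h.1.symm, h.2.2.1, h.2.1, fun c hc hx => h.2.2.2 c hc fun x hx' => hx x (by tauto)⟩

theorem IsNiceTriangle.swap_right {G : SimpleGraph V} {n : ℕ} {u v w : V}
    (h : G.IsNiceTriangle n u v w) : G.IsNiceTriangle n u w v :=
  ⟨h.2.1, h.1, h.2.2.1.symm, fun c hc hx => h.2.2.2 c hc fun x hx' => hx x (by tauto)⟩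

/-- A path and a further vertex adjacent to both its ends form a cycle. -/
theorem IsPathSeq.isCycleSeq_update {G : SimpleGraph V} {m : ℕ} {p : ℕ → V} {w : V}
    (hp : G.IsPathSeq m p) (hw : ∀ i ≤ m, p i ≠ w) (h0 : G.Adj w (p 0)) (hm : G.Adj (p m) w) :
    G.IsCycleSeq (m + 2) (Function.update p (m + 1) w) := by
  refine ⟨fun i hi j hj hij => ?_, fun i hi => ?_, ?_⟩
  · simp only [Set.mem_Iio] at hi hj
    simp only [Function.update_apply] at hij
    split_ifs at hij with h1 h2 h2
    · omega
    · exact absurd hij.symm (hw j (by omega))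
    · exact absurd hij (hw i (by omega))
    · exact hp.1 (by simp; omega) (by simp; omega) hij
  · rw [Function.update_of_ne (by omega)]
    rcases (show i < m ∨ i = m by omega) with h | rfl
    · rw [Function.update_of_ne (by omega)]
      exact hp.2 i h
    · rwa [Function.update_self]
  · rw [show m + 2 - 1 = m + 1 by omega, Function.update_self, Function.update_of_ne (by omega)]
    exact h0

/-- A nice triangle has no apex that closes a path through its opposite edge to a cycle. -/
theorem IsNiceTriangle.false_of_isPathSeq {G : SimpleGraph V} {m i j : ℕ} {p : ℕ → V} {w : V}
    (hp : G.IsPathSeq m p) (hw : ∀ i ≤ m, p i ≠ w) (h0 : G.Adj w (p 0)) (hm : G.Adj (p m) w)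
    (hi : i ≤ m) (hj : j ≤ m) (h : G.IsNiceTriangle (m + 2) (p i) (p j) w) : False := by
  refine h.2.2.2 _ (hp.isCycleSeq_update hw h0 hm) fun x hx => ?_
  rcases hx with rfl | rfl | rfl
  · exact ⟨i, by omega, Function.update_of_ne (by omega) _ _⟩
  · exact ⟨j, by omega, Function.update_of_ne (by omega) _ _⟩
  · exact ⟨m + 1, by omega, Function.update_self ..⟩

open Classical in
/-- The edges between the neighbours of `w` that form nice triangles with `w` are few, since they
contain no path on `2 * k` vertices. -/
theorem sum_link_le [Fintype V] (G : SimpleGraph V) {k : ℕ} (hk : 0 < k) (w : V) :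
    ∑ u, (Finset.univ.filter fun v => G.IsNiceTriangle (2 * k + 1) w u v).card ≤
      2 * (2 * k) *
        (Finset.univ.filter fun u => ∃ v, G.IsNiceTriangle (2 * k + 1) w u v).card := by
  obtain ⟨L, hL⟩ : ∃ L : SimpleGraph V, ∀ u v,
      L.Adj u v ↔ G.IsNiceTriangle (2 * k + 1) w u v :=
    ⟨{ Adj := fun u v => G.IsNiceTriangle (2 * k + 1) w u v
       symm := ⟨fun _ _ h => h.swap_right⟩
       loopless := ⟨fun u h => h.2.2.1.ne rfl⟩ }, fun _ _ => Iff.rfl⟩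
  simp only [← hL]
  set S := Finset.univ.filter fun u => ∃ v, L.Adj u v with hS
  have hmem : ∀ {u v}, L.Adj u v → u ∈ S := fun h => by
    rw [hS, Finset.mem_filter]; exact ⟨Finset.mem_univ _, _, h⟩
  have hsum : ∑ u, (Finset.univ.filter (L.Adj u)).card = ∑ u ∈ S, (S.filter (L.Adj u)).card := by
    rw [← Finset.sum_subset (Finset.subset_univ S)]
    · refine Finset.sum_congr rfl fun u _ => congrArg Finset.card (Finset.ext fun v => ?_)
      simp only [Finset.mem_filter, Finset.mem_univ, true_and]
      exact ⟨fun h => ⟨hmem h.symm, h⟩, fun h => h.2⟩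
    · intro u _ hu
      rw [Finset.card_eq_zero, Finset.filter_eq_empty_iff]
      exact fun v _ h => hu (hmem h)
  rw [hsum]
  by_contra hcon
  push Not at hcon
  obtain ⟨H, hHL, ⟨a, b, hab⟩, hdeg⟩ := exists_le_minDegree L hcon
  obtain ⟨N, p, hN, -, hp, hmax⟩ := IsPathSeq.exists_maximal (G := H) (n := 1)
    (p := fun i => if i = 0 then a else b)
    ⟨fun i hi j hj hij => by
        simp only [Set.mem_Iic] at hi hj
        have := hab.ne
        interval_cases i <;> interval_cases j <;> simp_all,
      fun i hi => by obtain rfl : i = 0 := by omega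
                     simpa using hab⟩
  have hadj := fun i hi => (hL _ _).1 (hHL (hp.2 i hi))
  -- All neighbours of the last vertex lie earlier on the maximal path, so its length is at least
  -- the minimum degree.
  have hNk : 2 * k ≤ N := by
    have h1 := hp.2 (N - 1) (by omega)
    rw [Nat.sub_add_cancel hN] at h1
    refine (hdeg (p N) ⟨_, h1.symm⟩).trans ?_
    refine (Finset.card_le_card (t := (Finset.range N).image p) fun u hu => ?_).trans
      (Finset.card_image_le.trans (Finset.card_range N).le)
    obtain ⟨j, hj, rfl⟩ := hmax u (by simpa using hu)
    exact Finset.mem_image_of_mem _ (by simpa using hj)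
  have hpG : G.IsPathSeq (2 * k - 1) p :=
    ⟨hp.1.mono fun i hi => by simp only [Set.mem_Iic] at hi ⊢; omega,
      fun i hi => (hadj i (by omega)).2.2.1⟩
  have hw : ∀ i ≤ 2 * k - 1, G.Adj w (p i) := fun i hi => (hadj i (by omega)).1
  refine IsNiceTriangle.false_of_isPathSeq hpG (fun i hi => (hw i hi).ne') (hw 0 (by omega))
    (hw _ le_rfl).symm (i := 0) (j := 1) (by omega) (by omega) ?_
  rw [show 2 * k - 1 + 2 = 2 * k + 1 by omega]
  exact (hadj 0 (by omega)).swap.swap_right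

open Classical in
/-- For three distinct points, a `1 / 27` proportion of all 3-colourings takes prescribed values. -/
theorem three_pow_card_le [Fintype V] {u v w : V} (huv : u ≠ v) (huw : u ≠ w) (hvw : v ≠ w) :
    3 ^ Fintype.card V ≤
      27 * (Finset.univ.filter fun f : V → Fin 3 => f u = 0 ∧ f v = 1 ∧ f w = 2).card := by
  -- Record the colours at the three points, then overwrite them by 0, 1, 2. The record makes this
  -- injective, and there are 27 records.
  have := Finset.card_le_card_of_injOn (s := (Finset.univ : Finset (V → Fin 3)))
    (t := (Finset.univ : Finset (Fin 3 × Fin 3 × Fin 3)) ×ˢ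
      Finset.univ.filter fun f : V → Fin 3 => f u = 0 ∧ f v = 1 ∧ f w = 2)
    (fun f => ((f u, f v, f w),
      Function.update (Function.update (Function.update f u 0) v 1) w 2))
    (fun f _ => by
      simp [Function.update_of_ne, huv, huw, hvw])
    (fun f _ g _ h => by
      simp only [Prod.mk.injEq] at h
      obtain ⟨⟨h1, h2, h3⟩, h4⟩ := h
      funext x
      by_cases hxw : x = w
      · rw [hxw, h3]
      by_cases hxv : x = v
      · rw [hxv, h2]
      by_cases hxu : x = u
      · rw [hxu, h1]
      simpa [hxw, hxv, hxu] using congrFun h4 x)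
  simpa [Finset.card_product] using this

theorem card_filter_prod [Fintype V] (P : V → V → Prop) [∀ u v, Decidable (P u v)] :
    (Finset.univ.filter fun x : V × V => P x.1 x.2).card =
      ∑ u, (Finset.univ.filter (P u)).card := by
  simp only [Finset.card_filter, Fintype.sum_prod_type]

open Classical in
/-- Few pairs of vertices are contained in nice triangles. -/
theorem sum_niceEdges_le [Fintype V] (G : SimpleGraph V) {k t : ℕ} (hk : 0 < k) (ht : 0 < t)
    (hcard : Fintype.card V < t ^ k) :
    ∑ u, (Finset.univ.filter fun v => ∃ w, G.IsNiceTriangle (2 * k + 1) u v w).card ≤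
      27 * (2 * (6 * k * (t + 3)) * Fintype.card V) := by
  rw [← card_filter_prod fun u v => ∃ w, G.IsNiceTriangle (2 * k + 1) u v w]
  set E := Finset.univ.filter fun x : V × V => ∃ w, G.IsNiceTriangle (2 * k + 1) x.1 x.2 w
    with hE
  have hEmem : ∀ x, ∃ w, x ∈ E → G.IsNiceTriangle (2 * k + 1) x.1 x.2 w := fun x => by
    by_cases hx : x ∈ E
    · have := hx
      rw [hE, Finset.mem_filter] at this
      exact this.2.imp fun w hw _ => hw
    · exact ⟨x.1, fun h => absurd h hx⟩
  choose apex hapex using hEmem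
  set M := 2 * (6 * k * (t + 3)) * Fintype.card V with hM
  have hf : ∀ f : V → Fin 3,
      (E.filter fun x => f x.1 = 0 ∧ f x.2 = 1 ∧ f (apex x) = 2).card ≤ M := by
    intro f
    obtain ⟨B, hB⟩ : ∃ B : SimpleGraph V, ∀ u v, B.Adj u v ↔
        ((f u = 0 ∧ f v = 1) ∨ (f u = 1 ∧ f v = 0)) ∧
          ∃ w, f w = 2 ∧ G.IsNiceTriangle (2 * k + 1) u v w :=
      ⟨{ Adj := fun u v => ((f u = 0 ∧ f v = 1) ∨ (f u = 1 ∧ f v = 0)) ∧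
          ∃ w, f w = 2 ∧ G.IsNiceTriangle (2 * k + 1) u v w
         symm := ⟨fun _ _ h => ⟨by tauto, h.2.imp fun _ hw => ⟨hw.1, hw.2.swap⟩⟩⟩
         loopless := ⟨fun _ ⟨_, _, _, h⟩ => h.1.ne rfl⟩ }, fun _ _ => Iff.rfl⟩
    have hBG : ∀ {u v}, B.Adj u v → G.Adj u v := fun h => by
      obtain ⟨-, w, -, hw⟩ := (hB _ _).1 h
      exact hw.1
    have hcol : ∀ u v, B.Adj u v → decide (f u = 0) ≠ decide (f v = 0) := fun u v h => by
      rcases ((hB _ _).1 h).1 with h | h <;> simp [h.1, h.2]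
    have hcyc : ∀ c, ¬ B.IsCycleSeq (2 * k) c := by
      intro c hc
      obtain ⟨-, w, hw2, hw⟩ := (hB _ _).1 hc.2.2
      -- The apex has colour 2, while every vertex of a cycle in `B` has colour 0 or 1.
      have hne : ∀ i ≤ 2 * k - 1, c i ≠ w := by
        rintro i hi rfl
        have hadj : ∃ x, B.Adj (c i) x := by
          rcases hi.eq_or_lt with rfl | hi
          · exact ⟨_, hc.2.2⟩
          · exact ⟨_, hc.2.1 i (by omega)⟩
        obtain ⟨x, hx⟩ := hadj
        rcases ((hB _ _).1 hx).1 with h | h <;> simp [hw2] at h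
      refine IsNiceTriangle.false_of_isPathSeq (m := 2 * k - 1) (p := c) (w := w)
        ⟨hc.1.mono fun i hi => by simp only [Set.mem_Iic, Set.mem_Iio] at hi ⊢; omega,
          fun i hi => hBG (hc.2.1 i (by omega))⟩ hne hw.2.2.1.symm hw.2.1
        (i := 2 * k - 1) (j := 0) (by omega) (by omega) ?_
      rwa [show 2 * k - 1 + 2 = 2 * k + 1 by omega]
    refine le_trans ?_ (sum_degree_le_of_forall_not_isCycleSeq hcol hk ht hcyc hcard)
    rw [← card_filter_prod B.Adj]
    refine Finset.card_le_card fun x hx => ?_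
    rw [Finset.mem_filter] at hx
    rw [Finset.mem_filter, hB]
    exact ⟨Finset.mem_univ _, Or.inl ⟨hx.2.1, hx.2.2.1⟩, _, hx.2.2.2, hapex x hx.1⟩
  -- Double counting of colourings against pairs: each colouring captures at most `M` pairs, and
  -- each pair is captured by at least 1/27 of the colourings.
  have hswap := Finset.sum_card_bipartiteAbove_eq_sum_card_bipartiteBelow
    (s := (Finset.univ : Finset (V → Fin 3))) (t := E)
    fun f x => f x.1 = 0 ∧ f x.2 = 1 ∧ f (apex x) = 2
  simp only [Finset.bipartiteAbove, Finset.bipartiteBelow] at hswap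
  have hupper := Finset.sum_le_sum fun f (_ : f ∈ (Finset.univ : Finset (V → Fin 3))) => hf f
  have hlower := Finset.sum_le_sum fun x hx =>
    three_pow_card_le (hapex x hx).1.ne (hapex x hx).2.1.ne (hapex x hx).2.2.1.ne
  rw [hswap] at hupper
  rw [← Finset.mul_sum] at hlower
  simp only [Finset.sum_const, Finset.card_univ, Fintype.card_fun, Fintype.card_fin,
    smul_eq_mul] at hupper hlower
  refine Nat.le_of_mul_le_mul_right (c := 3 ^ Fintype.card V) ?_ (by positivity)
  nlinarith

/-! ### From copies to triangles, and the asymptotic bound -/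

/-- A cyclic sequence of vertices gives a copy of the cycle graph through these vertices. -/
theorem IsCycleSeq.exists_isCopyOf {G : SimpleGraph V} {n : ℕ} {c : ℕ → V}
    (hc : G.IsCycleSeq n c) :
    ∃ G' : G.Subgraph, IsCopyOf (cycleGraph n) G' ∧ ∀ i < n, c i ∈ G'.verts := by
  have hstep : ∀ u v : Fin n, (u - v).val = 1 → G.Adj (c v) (c u) := by
    intro u v h
    have hn : 1 < n := by have := (u - v).isLt; omega
    rcases le_or_gt v u with hle | hlt
    · rw [Fin.sub_val_of_le hle] at h
      have := hc.2.1 v (by omega)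
      rwa [show (v : ℕ) + 1 = u by omega] at this
    · rw [Fin.coe_sub_iff_lt.2 hlt] at h
      have hu : (u : ℕ) = 0 := by omega
      have hv : (v : ℕ) = n - 1 := by omega
      rw [hu, hv]
      exact hc.2.2
  let φ : Copy (cycleGraph n) G :=
    ⟨⟨fun i => c i, fun {u v} h => by
      rw [cycleGraph_adj'] at h
      rcases h with h | h
      · exact (hstep u v h).symm
      · exact hstep v u h⟩,
     fun i j h => Fin.ext (hc.1 i.isLt j.isLt h)⟩
  refine ⟨φ.toSubgraph, ⟨φ.isoToSubgraph⟩, fun i hi => ?_⟩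
  simp only [Copy.toSubgraph, Subgraph.map_verts, Subgraph.verts_top, Set.image_univ]
  exact ⟨⟨i, hi⟩, rfl⟩

open Classical in
/-- The number of copies of the triangle aligning with no cycle of length `n` is at most the number
of nice triangles. -/
theorem niceCopyCount_le [Fintype V] (G : SimpleGraph V) {n : ℕ} :
    niceCopyCount (completeGraph (Fin 3)) (cycleGraph n) G ≤
      ∑ w, ∑ u, (Finset.univ.filter fun v => G.IsNiceTriangle n w u v).card := by
  have hcard : ∑ w, ∑ u, (Finset.univ.filter fun v => G.IsNiceTriangle n w u v).card =
      (Finset.univ.filter fun x : V × V × V => G.IsNiceTriangle n x.1 x.2.1 x.2.2).card := by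
    simp only [Finset.card_filter, Fintype.sum_prod_type]
  rw [hcard, niceCopyCount, ← Set.ncard_coe_finset]
  rcases isEmpty_or_nonempty V with hV | hV
  · refine (Nat.le_zero.2 ((Set.ncard_eq_zero (Set.toFinite _)).2 ?_)).trans (Nat.zero_le _)
    exact Set.eq_empty_of_forall_notMem fun G' ⟨⟨φ⟩, _⟩ => hV.false (φ 0 : V)
  -- The last clause says that a triangle copy is complete on its vertex set, so the triple
  -- determines it; this gives injectivity of `F`.
  have hiso : ∀ G' : G.Subgraph, ∃ x : V × V × V,
      IsNiceCopy (completeGraph (Fin 3)) (cycleGraph n) G' →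
        G.IsNiceTriangle n x.1 x.2.1 x.2.2 ∧ G'.verts = {x.1, x.2.1, x.2.2} ∧
          ∀ a b, G'.Adj a b ↔ a ∈ G'.verts ∧ b ∈ G'.verts ∧ a ≠ b := by
    intro G'
    by_cases hG' : IsNiceCopy (completeGraph (Fin 3)) (cycleGraph n) G'
    · obtain ⟨⟨φ⟩, hal⟩ := hG'
      have hverts : G'.verts = {(φ 0 : V), (φ 1 : V), (φ 2 : V)} := by
        ext y
        simp only [Set.mem_insert_iff, Set.mem_singleton_iff]
        constructor
        · intro hy
          obtain ⟨i, hi⟩ := φ.surjective ⟨y, hy⟩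
          have hi' : (φ i : V) = y := congrArg Subtype.val hi
          rw [← hi']
          fin_cases i <;> simp
        · rintro (rfl | rfl | rfl) <;> exact Subtype.property _
      have hadj : ∀ i j, i ≠ j → G.Adj (φ i) (φ j) := fun i j hij =>
        (show G'.Adj (φ i) (φ j) from φ.map_rel_iff.2 hij).adj_sub
      refine ⟨(φ 0, φ 1, φ 2), fun _ => ⟨⟨hadj _ _ (by decide), hadj _ _ (by decide),
        hadj _ _ (by decide), fun c hc hx => ?_⟩, hverts, fun a b => ?_⟩⟩
      · obtain ⟨G'', hG'', hmem⟩ := hc.exists_isCopyOf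
        refine hal G'' hG'' (Or.inl fun y hy => ?_)
        rw [hverts] at hy
        obtain ⟨i, hi, rfl⟩ := hx y (by simpa using hy)
        exact hmem i hi
      · refine ⟨fun h => ⟨h.fst_mem, h.snd_mem, h.ne⟩, fun ⟨ha, hb, hne⟩ => ?_⟩
        obtain ⟨i, hi⟩ := φ.surjective ⟨a, ha⟩
        obtain ⟨j, hj⟩ := φ.surjective ⟨b, hb⟩
        have hij : i ≠ j := by
          rintro rfl
          exact hne (congrArg Subtype.val (hi.symm.trans hj))
        have : G'.coe.Adj (φ i) (φ j) := φ.map_rel_iff.2 hij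
        rw [hi, hj] at this
        exact this
    · exact ⟨Classical.arbitrary _, fun h => absurd h hG'⟩
  choose F hF using hiso
  refine Set.ncard_le_ncard_of_injOn F (fun G' hG' => ?_) (fun G₁ h₁ G₂ h₂ h => ?_)
    (Finset.finite_toSet _)
  · simpa using (hF G' hG').1
  · have hv : G₁.verts = G₂.verts := by rw [(hF G₁ h₁).2.1, (hF G₂ h₂).2.1, h]
    refine Subgraph.ext hv ?_
    funext a b
    rw [(hF G₁ h₁).2.2, (hF G₂ h₂).2.2, hv]

/-- The constant is `4 * 27 * 12`: from the links, the colourings and the Bondy–Simonovits bound. -/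
theorem niceCopyCount_triangle_cycle_le [Fintype V] (G : SimpleGraph V) {k t : ℕ} (hk : 0 < k)
    (ht : 0 < t) (hcard : Fintype.card V < t ^ k) :
    niceCopyCount (completeGraph (Fin 3)) (cycleGraph (2 * k + 1)) G ≤
      1296 * k ^ 2 * (t + 3) * Fintype.card V := by
  classical
  calc _ ≤ _ := niceCopyCount_le G
    _ ≤ _ := Finset.sum_le_sum fun w _ => sum_link_le G hk w
    _ = _ := (Finset.mul_sum ..).symm
    _ ≤ _ := Nat.mul_le_mul_left _ (sum_niceEdges_le G hk ht hcard)
    _ = _ := by ring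

end SimpleGraph

theorem proposition5 (k : ℕ) (hk : 2 ≤ k) :
    (fun n : ℕ =>
        (exRe n (SimpleGraph.completeGraph (Fin 3)) (SimpleGraph.cycleGraph (2 * k + 1)) : ℝ))
      =O[atTop] (fun n : ℕ => (n : ℝ) ^ (1 + 1 / (k : ℝ))) := by
  refine IsBigO.of_bound (1296 * k ^ 2 * 5) ?_
  filter_upwards [eventually_ge_atTop 1] with n hn
  have hk0 : (k : ℝ) ≠ 0 := by positivity
  have hn1 : (1 : ℝ) ≤ n := by exact_mod_cast hn
  obtain ⟨G, hG⟩ := (exRe_isGreatest n (SimpleGraph.completeGraph (Fin 3))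
    (SimpleGraph.cycleGraph (2 * k + 1))).1
  have hroot : (1 : ℝ) ≤ (n : ℝ) ^ (1 / (k : ℝ)) := Real.one_le_rpow hn1 (by positivity)
  -- The added 1 gives the strict bound `n < t ^ k`. Since the root is at least 1, `t + 3` is at
  -- most five times the root, whence the factor 5.
  set t := ⌊(n : ℝ) ^ (1 / (k : ℝ))⌋₊ + 1 with ht
  have hlt : (n : ℝ) ^ (1 / (k : ℝ)) < t := by
    rw [ht]; exact_mod_cast Nat.lt_floor_add_one _
  have hle : (t : ℝ) ≤ (n : ℝ) ^ (1 / (k : ℝ)) + 1 := by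
    rw [ht]; push_cast
    have := Nat.floor_le (zero_le_one.trans hroot)
    linarith
  have hpow : n < t ^ k := by
    have h1 : ((n : ℝ) ^ (1 / (k : ℝ))) ^ k = n := by
      rw [← Real.rpow_natCast, ← Real.rpow_mul (by positivity), one_div_mul_cancel hk0,
        Real.rpow_one]
    have h2 := pow_lt_pow_left₀ hlt (by positivity) (n := k) (by omega)
    rw [h1] at h2
    exact_mod_cast h2
  have hmain := G.niceCopyCount_triangle_cycle_le (k := k) (t := t) (by omega) (by omega)
    (by simpa using hpow)
  simp only at hG
  rw [hG, Fintype.card_fin] at hmain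
  have hmain' : (exRe n (SimpleGraph.completeGraph (Fin 3))
      (SimpleGraph.cycleGraph (2 * k + 1)) : ℝ) ≤ 1296 * k ^ 2 * (t + 3) * n := by
    exact_mod_cast hmain
  rw [Real.norm_of_nonneg (by positivity), Real.norm_of_nonneg (by positivity),
    Real.rpow_add (by positivity), Real.rpow_one]
  calc _ ≤ _ := hmain'
    _ ≤ 1296 * (k : ℝ) ^ 2 * (5 * (n : ℝ) ^ (1 / (k : ℝ))) * n := by
      gcongr
      linarith
    _ = _ := by ring
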